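/- Let $m \ge 2$, let $D \subset \mathbb{R}^m$ be a bounded domain (a nonempty, open and connected set), let $v \in C^0(D)$ be real-valued and let $\mu > 0$. For each $x \in D$ let $r(x) > 0$ be such that the closed ball $\overline{B_{r(x)}(x)}$ is contained in $D$. Suppose that $$\tilde a^\circ(\mu r)\, v(x) = \frac{1}{|\partial B_r|} \int_{\partial B_r(x)} v(y)\, \mathrm{d}S_y \qquad \text{for every } x \in D \text{ and all } r \in (0, r(x)),$$ where $|\partial B_r| = 2\pi^{m/2} r^{m-1}/\Gamma(m/2)$ is the area of the sphere of radius $r$ and $$\tilde a^\circ(t) = \Gamma\!\left(\frac m2\right) \frac{I_{(m-2)/2}(t)}{(t/2)^{(m-2)/2}}, \qquad t > 0,$$ with $I_\nu$ the modified Bessel function of order $\nu$. Then $v \in C^2(D)$ and $v$ satisfies the modified Helmholtz equation $\nabla^2 v - \mu^2 v = 0$ in $D$. -/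

import Mathlib

noncomputable section

namespace ModifiedHelmholtz

/-- The modified Bessel function `I_ν(z)` for real order `ν` and real argument `z > 0`,
`I_ν(z) = ∑ₖ (z/2)^(2k+ν) / (k! Γ(k+ν+1))`. (At the poles of `Γ` Mathlib's `Real.Gamma` is `0`,
so such terms vanish, in accordance with the convention `1/Γ = 0` there.) -/
def besselI (ν z : ℝ) : ℝ :=
  ∑' k : ℕ, (z / 2) ^ (2 * (k : ℝ) + ν) / ((k.factorial : ℝ) * Real.Gamma ((k : ℝ) + ν + 1))

/-- The coefficient `Γ(m/2) I_{(m-2)/2}(t) / (t/2)^((m-2)/2)` of the mean value formula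
for spheres in `ℝ^m`. -/
def meanCoeff (m : ℕ) (t : ℝ) : ℝ :=
  Real.Gamma ((m : ℝ) / 2) * besselI (((m : ℝ) - 2) / 2) t / (t / 2) ^ (((m : ℝ) - 2) / 2)

/-- The area `|∂B_r| = 2 π^(m/2) r^(m-1) / Γ(m/2)` of a sphere of radius `r` in `ℝ^m`. -/
def sphereArea (m : ℕ) (r : ℝ) : ℝ :=
  2 * Real.pi ^ ((m : ℝ) / 2) * r ^ ((m : ℝ) - 1) / Real.Gamma ((m : ℝ) / 2)

/-- The surface integral `∫_{∂B_r(x)} v dS` for `r > 0`, written through the surface measure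
(`MeasureTheory.Measure.toSphere` of Lebesgue measure) of the unit sphere, by `y = x + r θ` and
`dS_y = r^(m-1) dS_θ`. -/
def sphereIntegral {m : ℕ} (v : EuclideanSpace ℝ (Fin m) → ℝ) (x : EuclideanSpace ℝ (Fin m))
    (r : ℝ) : ℝ :=
  r ^ ((m : ℝ) - 1) *
    ∫ θ : Metric.sphere (0 : EuclideanSpace ℝ (Fin m)) 1, v (x + r • (θ : EuclideanSpace ℝ (Fin m)))
      ∂(MeasureTheory.volume : MeasureTheory.Measure (EuclideanSpace ℝ (Fin m))).toSphere

/-- The mean value of `v` over the sphere `∂B_r(x)`. -/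
def sphereMean {m : ℕ} (v : EuclideanSpace ℝ (Fin m) → ℝ) (x : EuclideanSpace ℝ (Fin m))
    (r : ℝ) : ℝ :=
  1 / sphereArea m r * sphereIntegral v x r

end ModifiedHelmholtz

end

noncomputable section

namespace ModifiedHelmholtz

open MeasureTheory Metric Filter Topology
open scoped Pointwise Convolution

/-! For a `C^2` function the equation follows by letting `r → 0`: the mean over `∂B_r(x)` is `v + r²
∇²v / (2m) + o(r²)` (`tendsto_sphereMean`), while the coefficient is `1 + μ² r² / (2m) + o(r²)`
(`tendsto_meanCoeff`).

The real task is regularity, and it needs no solution of a Dirichlet problem. The exponentials `exp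
(μ ⟪ξ, x - x₀⟫)` with `‖ξ‖ = 1` solve the equation, and their span is dense in the continuous
functions on any sphere about `x₀` (`dense_span_sphereExp`). So `v` is uniformly close on the sphere
to some `w` in the span, and the comparison principle `sub_le_of_sub_le_on_sphere`, which uses only
the mean value property of `v`, carries this closeness into the ball. Averaging against a radial
bump multiplies every such `w` by one constant `C > 0` (`exists_integral_radialBump_mul`), hence
also the uniform limit `v` near `x₀`. There `v` is `C⁻¹` times a `C^2` convolution. -/

/-! ### Low-order moments of the surface measure on the unit sphere -/

/-- A linear isometry equivalence acts on the unit sphere. -/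
def sphereEquiv {m : ℕ} (L : EuclideanSpace ℝ (Fin m) ≃ₗᵢ[ℝ] EuclideanSpace ℝ (Fin m)) :
    sphere (0 : EuclideanSpace ℝ (Fin m)) 1 ≃ₜ sphere (0 : EuclideanSpace ℝ (Fin m)) 1 where
  toFun θ := ⟨L θ, by simp⟩
  invFun θ := ⟨L.symm θ, by simp⟩
  left_inv θ := by simp
  right_inv θ := by simp
  continuous_toFun := by fun_prop
  continuous_invFun := by fun_prop

/-- `toSphere` measures a set by the volume of the cone over it; an isometry maps cones to cones and
preserves volume. -/
theorem measurePreserving_sphereEquiv {m : ℕ}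
    (L : EuclideanSpace ℝ (Fin m) ≃ₗᵢ[ℝ] EuclideanSpace ℝ (Fin m)) :
    MeasurePreserving (sphereEquiv L)
      (volume : Measure (EuclideanSpace ℝ (Fin m))).toSphere
      (volume : Measure (EuclideanSpace ℝ (Fin m))).toSphere := by
  refine ⟨(sphereEquiv L).measurable, ?_⟩
  ext s hs
  rw [Measure.map_apply (sphereEquiv L).measurable hs,
    Measure.toSphere_apply' _ ((sphereEquiv L).measurable hs), Measure.toSphere_apply' _ hs]
  congr 1
  rw [← L.measurePreserving.measure_preimage_equiv (f := L.toMeasurableEquiv)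
    (Set.Ioo (0 : ℝ) 1 • (Subtype.val '' s))]
  congr 1
  ext x
  simp only [Set.mem_smul, Set.mem_image, Set.mem_preimage]
  constructor
  · rintro ⟨r, hr, _, ⟨θ, hθ, rfl⟩, rfl⟩
    exact ⟨r, hr, _, ⟨_, hθ, rfl⟩, by simp [sphereEquiv]⟩
  · rintro ⟨r, hr, _, ⟨θ, hθ, rfl⟩, h⟩
    refine ⟨r, hr, _, ⟨(sphereEquiv L).symm θ, by simpa using hθ, rfl⟩, ?_⟩
    apply L.injective
    simpa [sphereEquiv] using h

theorem integral_sphere_comp_isometry {m : ℕ}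
    (L : EuclideanSpace ℝ (Fin m) ≃ₗᵢ[ℝ] EuclideanSpace ℝ (Fin m))
    (f : EuclideanSpace ℝ (Fin m) → ℝ) :
    ∫ θ : sphere (0 : EuclideanSpace ℝ (Fin m)) 1, f (L θ)
        ∂(volume : Measure (EuclideanSpace ℝ (Fin m))).toSphere =
      ∫ θ : sphere (0 : EuclideanSpace ℝ (Fin m)) 1, f θ
        ∂(volume : Measure (EuclideanSpace ℝ (Fin m))).toSphere :=
  (measurePreserving_sphereEquiv L).integral_comp (sphereEquiv L).measurableEmbedding
    (fun θ => f θ)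

theorem integral_sphere_linear {m : ℕ} (l : EuclideanSpace ℝ (Fin m) →L[ℝ] ℝ) :
    ∫ θ : sphere (0 : EuclideanSpace ℝ (Fin m)) 1, l θ
      ∂(volume : Measure (EuclideanSpace ℝ (Fin m))).toSphere = 0 := by
  have h := integral_sphere_comp_isometry (LinearIsometryEquiv.neg ℝ) (fun x => l x)
  simp only [LinearIsometryEquiv.coe_neg, map_neg, integral_neg] at h
  linarith

/-- Reflecting the `i`-th coordinate changes the sign of the integrand. -/
theorem integral_sphere_mul_of_ne {m : ℕ} {i j : Fin m} (hij : i ≠ j) :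
    ∫ θ : sphere (0 : EuclideanSpace ℝ (Fin m)) 1, θ.1 i * θ.1 j
      ∂(volume : Measure (EuclideanSpace ℝ (Fin m))).toSphere = 0 := by
  have h := integral_sphere_comp_isometry
    (LinearIsometryEquiv.piLpCongrRight 2 (fun k : Fin m =>
      if k = i then LinearIsometryEquiv.neg ℝ (E := ℝ) else LinearIsometryEquiv.refl ℝ ℝ))
    (fun x => x i * x j)
  have hj : j ≠ i := hij.symm
  simp only [LinearIsometryEquiv.piLpCongrRight_apply, if_true, hj, if_false,
    LinearIsometryEquiv.coe_neg, LinearIsometryEquiv.coe_refl, id, neg_mul, integral_neg] at h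
  linarith

theorem integrable_sphere {m : ℕ} {f : sphere (0 : EuclideanSpace ℝ (Fin m)) 1 → ℝ}
    (hf : Continuous f) :
    Integrable f (volume : Measure (EuclideanSpace ℝ (Fin m))).toSphere :=
  hf.integrable_of_hasCompactSupport (HasCompactSupport.of_compactSpace f)

/-- Coordinate swaps make the `m` second moments equal, and they add up to the integral of `‖θ‖² =
1`. -/
theorem integral_sphere_sq {m : ℕ} (hm : 2 ≤ m) (i : Fin m) :
    ∫ θ : sphere (0 : EuclideanSpace ℝ (Fin m)) 1, θ.1 i * θ.1 i
      ∂(volume : Measure (EuclideanSpace ℝ (Fin m))).toSphere =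
    (volume : Measure (EuclideanSpace ℝ (Fin m))).toSphere.real Set.univ / m := by
  have h (j : Fin m) := integral_sphere_comp_isometry
    (LinearIsometryEquiv.piLpCongrLeft 2 ℝ ℝ (Equiv.swap i j)) (fun x => x i * x i)
  simp only [LinearIsometryEquiv.piLpCongrLeft_apply, Equiv.piCongrLeft', Equiv.coe_fn_mk,
    Equiv.symm_swap, Equiv.swap_apply_left] at h
  have hs : ∑ j : Fin m, ∫ θ : sphere (0 : EuclideanSpace ℝ (Fin m)) 1, θ.1 j * θ.1 j
      ∂(volume : Measure (EuclideanSpace ℝ (Fin m))).toSphere =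
      (volume : Measure (EuclideanSpace ℝ (Fin m))).toSphere.real Set.univ := by
    rw [← integral_finsetSum _ (fun j _ => integrable_sphere (by fun_prop))]
    rw [← mul_one ((volume : Measure (EuclideanSpace ℝ (Fin m))).toSphere.real Set.univ),
      ← smul_eq_mul, ← integral_const]
    congr 1 with θ
    have := EuclideanSpace.real_norm_sq_eq θ.1
    simp only [norm_eq_of_mem_sphere θ] at this
    simp only [← pow_two]
    linarith
  rw [Finset.sum_congr rfl (fun j _ => h j), Finset.sum_const] at hs
  have : (m : ℝ) ≠ 0 := by positivity
  rw [← hs]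
  simp
  field_simp

/-! ### Small-radius expansion of spherical means -/

theorem sphereMean_eq {m : ℕ} (hm : 2 ≤ m) (v : EuclideanSpace ℝ (Fin m) → ℝ)
    (x : EuclideanSpace ℝ (Fin m)) {r : ℝ} (hr : 0 < r) :
    sphereMean v x r =
      ((volume : Measure (EuclideanSpace ℝ (Fin m))).toSphere.real Set.univ)⁻¹ *
      ∫ θ : sphere (0 : EuclideanSpace ℝ (Fin m)) 1, v (x + r • (θ : EuclideanSpace ℝ (Fin m)))
      ∂(volume : Measure (EuclideanSpace ℝ (Fin m))).toSphere := by
  have hm0 : (0 : ℝ) < m := by positivity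
  have : Nonempty (Fin m) := ⟨⟨0, by omega⟩⟩
  have hvol : (volume : Measure (EuclideanSpace ℝ (Fin m))).toSphere.real Set.univ =
      2 * Real.pi ^ ((m : ℝ) / 2) / Real.Gamma ((m : ℝ) / 2) := by
    rw [Measure.toSphere_real_apply_univ, measureReal_def, EuclideanSpace.volume_ball]
    have hG : 0 < Real.Gamma ((m : ℝ) / 2) := Real.Gamma_pos_of_pos (by positivity)
    have hp : √Real.pi ^ m = Real.pi ^ ((m : ℝ) / 2) := by
      rw [Real.sqrt_eq_rpow, ← Real.rpow_natCast, ← Real.rpow_mul Real.pi_pos.le]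
      ring_nf
    simp only [Fintype.card_fin, ENNReal.ofReal_one, one_pow, one_mul, finrank_euclideanSpace, hp]
    rw [Real.Gamma_add_one (by positivity), ENNReal.toReal_ofReal (by positivity)]
    field_simp
  have hr' : 0 < r ^ ((m : ℝ) - 1) := Real.rpow_pos_of_pos hr _
  have hG : 0 < Real.Gamma ((m : ℝ) / 2) := Real.Gamma_pos_of_pos (by positivity)
  have hp : 0 < Real.pi ^ ((m : ℝ) / 2) := Real.rpow_pos_of_pos Real.pi_pos _
  rw [hvol, sphereMean, sphereArea, sphereIntegral]
  field_simp

theorem toSphere_real_univ_pos {m : ℕ} (hm : 2 ≤ m) :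
    0 < (volume : Measure (EuclideanSpace ℝ (Fin m))).toSphere.real Set.univ := by
  have : Nonempty (Fin m) := ⟨⟨0, by omega⟩⟩
  rw [Measure.toSphere_real_apply_univ]
  have : 0 < (volume : Measure (EuclideanSpace ℝ (Fin m))).real (ball 0 1) :=
    ENNReal.toReal_pos (measure_ball_pos _ _ one_pos).ne' measure_ball_lt_top.ne
  have hm0 : (0 : ℝ) < m := by positivity
  simp only [finrank_euclideanSpace, Fintype.card_fin]
  positivity

/-- The remainder, as a function of `h`, has derivative `o(‖h‖)` because `fderiv ℝ f` is
differentiable at `x`; the mean value inequality on the ball of radius `‖h‖` gains one more factor.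
Symmetry of the second derivative is what cancels the factor `2⁻¹`. -/
theorem taylor_two_isLittleO {E : Type*} [NormedAddCommGroup E] [NormedSpace ℝ E]
    {f : E → ℝ} {x : E} (hf : ContDiffAt ℝ 2 f x) {ε : ℝ} (hε : 0 < ε) :
    ∃ δ > 0, ∀ h : E, ‖h‖ < δ →
      |f (x + h) - f x - fderiv ℝ f x h - 2⁻¹ * fderiv ℝ (fderiv ℝ f) x h h| ≤ ε * ‖h‖ ^ 2 := by
  have hd : ContDiffAt ℝ 1 (fderiv ℝ f) x := hf.fderiv_right (by norm_num)
  have hd2 := (hd.differentiableAt one_ne_zero).hasFDerivAt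
  have hsymm : IsSymmSndFDerivAt ℝ f x := hf.isSymmSndFDerivAt (by simp)
  have hev : ∀ᶠ y in 𝓝 x, DifferentiableAt ℝ f y :=
    (hf.eventually (by simp)).mono fun y hy => hy.differentiableAt two_ne_zero
  have hlo := hd2.isLittleO.def hε
  obtain ⟨δ, hδ, hball⟩ := Metric.eventually_nhds_iff_ball.1 (hev.and hlo)
  refine ⟨δ, hδ, fun h hh => ?_⟩
  let F : E → ℝ := fun z => f (x + z) - f x - fderiv ℝ f x z - 2⁻¹ * fderiv ℝ (fderiv ℝ f) x z z
  have hF : ∀ z ∈ closedBall (0 : E) ‖h‖, HasFDerivWithinAt F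
      (fderiv ℝ f (x + z) - fderiv ℝ f x - fderiv ℝ (fderiv ℝ f) x z) (closedBall 0 ‖h‖) z := by
    intro z hz
    have hz' : x + z ∈ ball x δ := by
      simpa using (mem_closedBall_zero_iff.1 hz).trans_lt hh
    have h1 : HasFDerivAt (fun z => f (x + z)) (fderiv ℝ f (x + z)) z := by
      simpa [Function.comp_def] using (hball _ hz').1.hasFDerivAt.comp z ((hasFDerivAt_id z).const_add x)
    have h2 := (fderiv ℝ (fderiv ℝ f) x).hasFDerivAt_of_bilinear
      (hasFDerivAt_id z) (hasFDerivAt_id z)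
    have h3 := ((h1.sub_const (f x)).sub (fderiv ℝ f x).hasFDerivAt).sub (h2.const_mul 2⁻¹)
    refine (h3.congr_fderiv ?_).hasFDerivWithinAt
    ext w
    have := hsymm z w
    simp [ContinuousLinearMap.precompR, ContinuousLinearMap.precompL, this]
    ring
  have hb : ∀ z ∈ closedBall (0 : E) ‖h‖,
      ‖fderiv ℝ f (x + z) - fderiv ℝ f x - fderiv ℝ (fderiv ℝ f) x z‖ ≤ ε * ‖h‖ := by
    intro z hz
    have hz0 := mem_closedBall_zero_iff.1 hz
    have hz' : x + z ∈ ball x δ := by simpa using hz0.trans_lt hh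
    have := (hball _ hz').2
    simp only [add_sub_cancel_left] at this
    exact this.trans (by gcongr)
  have := (convex_closedBall (0 : E) ‖h‖).norm_image_sub_le_of_norm_hasFDerivWithin_le hF hb
    (mem_closedBall_self (norm_nonneg h)) (by simp : h ∈ closedBall (0 : E) ‖h‖)
  have hF0 : F 0 = 0 := by simp [F]
  rw [hF0, sub_zero, sub_zero, Real.norm_eq_abs] at this
  calc _ ≤ _ := this
    _ = _ := by ring

theorem integral_sphere_hessian {m : ℕ} (hm : 2 ≤ m) (f : EuclideanSpace ℝ (Fin m) → ℝ)
    (x : EuclideanSpace ℝ (Fin m)) :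
    ∫ θ : sphere (0 : EuclideanSpace ℝ (Fin m)) 1, fderiv ℝ (fderiv ℝ f) x θ θ
      ∂(volume : Measure (EuclideanSpace ℝ (Fin m))).toSphere =
    (volume : Measure (EuclideanSpace ℝ (Fin m))).toSphere.real Set.univ / m *
      Laplacian.laplacian f x := by
  set B := fderiv ℝ (fderiv ℝ f) x
  let b := EuclideanSpace.basisFun (Fin m) ℝ
  have hB (θ : EuclideanSpace ℝ (Fin m)) :
      B θ θ = ∑ i, ∑ j, B (b i) (b j) * (θ i * θ j) := by
    conv_lhs => rw [← b.sum_repr θ]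
    simp only [map_sum, sum_apply, map_smul, smul_apply,
      smul_eq_mul, b, EuclideanSpace.basisFun_repr]
    simp only [Finset.mul_sum]
    rw [Finset.sum_comm]
    exact Finset.sum_congr rfl fun i _ => Finset.sum_congr rfl fun j _ => by ring
  simp only [hB]
  rw [integral_finsetSum _ (fun j _ => integrable_sphere (by fun_prop))]
  rw [InnerProductSpace.laplacian_eq_iteratedFDeriv_orthonormalBasis f b, Finset.mul_sum]
  refine Finset.sum_congr rfl fun i _ => ?_
  rw [integral_finsetSum _ (fun j _ => integrable_sphere (by fun_prop)),
    Finset.sum_eq_single i]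
  · rw [integral_const_mul, integral_sphere_sq hm, iteratedFDeriv_two_apply]
    simp [B, mul_comm]
  · intro j _ hj
    rw [integral_const_mul, integral_sphere_mul_of_ne hj.symm, mul_zero]
  · simp

theorem tendsto_sphereMean {m : ℕ} (hm : 2 ≤ m) {f : EuclideanSpace ℝ (Fin m) → ℝ}
    {x : EuclideanSpace ℝ (Fin m)} (hf : ContDiffAt ℝ 2 f x) :
    Tendsto (fun r => (sphereMean f x r - f x) / r ^ 2) (𝓝[>] 0)
      (𝓝 (Laplacian.laplacian f x / (2 * m))) := by
  have hS := toSphere_real_univ_pos hm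
  have hm0 : (0 : ℝ) < m := by positivity
  have hcont : ∀ᶠ y in 𝓝 x, ContinuousAt f y :=
    (hf.eventually (by simp)).mono fun y hy => hy.continuousAt
  obtain ⟨δ', hδ', hc⟩ := Metric.eventually_nhds_iff_ball.1 hcont
  rw [Metric.tendsto_nhds]
  intro ε hε
  obtain ⟨δ, hδ, hT⟩ := taylor_two_isLittleO hf (half_pos hε)
  -- `δ` controls the Taylor remainder; `δ'` keeps the sphere where `f` is continuous, hence
  -- integrable.
  have h1 : ∀ᶠ r : ℝ in 𝓝[>] 0, r < min δ δ' :=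
    nhdsWithin_le_nhds (eventually_lt_nhds (lt_min hδ hδ'))
  filter_upwards [h1, self_mem_nhdsWithin] with r hr hr0
  replace hr0 : 0 < r := hr0
  set σ := (volume : Measure (EuclideanSpace ℝ (Fin m))).toSphere
  have hnorm (θ : sphere (0 : EuclideanSpace ℝ (Fin m)) 1) :
      ‖r • (θ : EuclideanSpace ℝ (Fin m))‖ = r := by
    rw [norm_smul, norm_eq_of_mem_sphere, mul_one, Real.norm_of_nonneg hr0.le]
  have hfi : Continuous fun θ : sphere (0 : EuclideanSpace ℝ (Fin m)) 1 =>
      f (x + r • (θ : EuclideanSpace ℝ (Fin m))) := by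
    refine continuous_iff_continuousAt.2 fun θ => ?_
    refine ContinuousAt.comp (f := fun θ : sphere (0 : EuclideanSpace ℝ (Fin m)) 1 =>
      x + r • (θ : EuclideanSpace ℝ (Fin m))) (hc _ ?_) (by fun_prop)
    simpa [hnorm] using hr.trans_le (min_le_right _ _)
  let R : sphere (0 : EuclideanSpace ℝ (Fin m)) 1 → ℝ := fun θ =>
    f (x + r • (θ : EuclideanSpace ℝ (Fin m))) - f x - r * fderiv ℝ f x θ -
      2⁻¹ * r ^ 2 * fderiv ℝ (fderiv ℝ f) x θ θ
  have hR : ∀ θ, ‖R θ‖ ≤ ε / 2 * r ^ 2 := by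
    intro θ
    have := hT (r • (θ : EuclideanSpace ℝ (Fin m))) (by
      rw [hnorm]; exact hr.trans_le (min_le_left _ _))
    rw [hnorm] at this
    refine le_trans (le_of_eq ?_) this
    simp only [R, map_smul, smul_apply, smul_eq_mul, Real.norm_eq_abs]
    ring_nf
  have hRi : ‖∫ θ, R θ ∂σ‖ ≤ ε / 2 * r ^ 2 * σ.real Set.univ :=
    norm_integral_le_of_norm_le_const (Eventually.of_forall hR)
  have hc1 : Continuous fun θ : sphere (0 : EuclideanSpace ℝ (Fin m)) 1 =>
      r * fderiv ℝ f x θ := by fun_prop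
  have hc2 : Continuous fun θ : sphere (0 : EuclideanSpace ℝ (Fin m)) 1 =>
      2⁻¹ * r ^ 2 * fderiv ℝ (fderiv ℝ f) x θ θ := by fun_prop
  have hcf := hfi.sub (continuous_const (y := f x))
  have hcR := hcf.sub hc1
  simp only [Pi.sub_def] at hcf hcR
  have hcalc : ∫ θ, R θ ∂σ = σ.real Set.univ * (sphereMean f x r - f x -
      r ^ 2 * (Laplacian.laplacian f x / (2 * m))) := by
    simp only [R]
    rw [integral_sub (integrable_sphere hcR) (integrable_sphere hc2),
      integral_sub (integrable_sphere hcf) (integrable_sphere hc1),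
      integral_sub (integrable_sphere hfi) (integrable_const _), integral_const_mul,
      integral_const_mul, integral_sphere_linear, integral_sphere_hessian hm, integral_const,
      sphereMean_eq hm f x hr0]
    simp only [smul_eq_mul]
    simp only [σ]
    have hS' := toSphere_real_univ_pos hm
    field_simp
    ring
  rw [hcalc, norm_mul, Real.norm_of_nonneg hS.le, mul_comm, Real.norm_eq_abs] at hRi
  have h3 := le_of_mul_le_mul_right hRi hS
  rw [Real.dist_eq]
  have : (sphereMean f x r - f x) / r ^ 2 - Laplacian.laplacian f x / (2 * m) =
      (sphereMean f x r - f x - r ^ 2 * (Laplacian.laplacian f x / (2 * m))) / r ^ 2 := by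
    field_simp
  rw [this, abs_div, abs_of_pos (by positivity : 0 < r ^ 2), div_lt_iff₀ (by positivity)]
  have : 0 < ε * r ^ 2 := by positivity
  linarith

/-! ### Small-argument expansion of the Bessel coefficient -/

theorem Gamma_le_Gamma_natCast_add {a : ℝ} (ha : 1 ≤ a) (k : ℕ) :
    Real.Gamma a ≤ Real.Gamma ((k : ℝ) + a) := by
  induction k with
  | zero => simp
  | succ k ih =>
    have hk : (1 : ℝ) ≤ (k : ℝ) + a := by
      have : (0 : ℝ) ≤ k := by positivity
      linarith
    have h1 : ((k + 1 : ℕ) : ℝ) + a = ((k : ℝ) + a) + 1 := by push_cast; ring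
    rw [h1, Real.Gamma_add_one (by linarith)]
    have := Real.Gamma_pos_of_pos (show 0 < (k : ℝ) + a by linarith)
    nlinarith

/-- The coefficients of the expansion of `meanCoeff m t` in powers of `(t / 2) ^ 2`. -/
def meanCoeffSeries (m k : ℕ) : ℝ :=
  Real.Gamma ((m : ℝ) / 2) / ((k.factorial : ℝ) * Real.Gamma ((k : ℝ) + (m : ℝ) / 2))

theorem meanCoeff_eq_tsum (m : ℕ) {t : ℝ} (ht : 0 < t) :
    meanCoeff m t = ∑' k : ℕ, meanCoeffSeries m k * ((t / 2) ^ 2) ^ k := by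
  have ht2 : 0 < t / 2 := by positivity
  have hp : 0 < (t / 2) ^ (((m : ℝ) - 2) / 2) := Real.rpow_pos_of_pos ht2 _
  rw [meanCoeff, besselI, ← tsum_mul_left, ← tsum_div_const]
  refine tsum_congr fun k => ?_
  have h1 : (k : ℝ) + ((m : ℝ) - 2) / 2 + 1 = (k : ℝ) + (m : ℝ) / 2 := by ring
  have h2 : (t / 2) ^ (2 * (k : ℝ)) = ((t / 2) ^ 2) ^ k := by
    rw [← pow_mul, ← Real.rpow_natCast]; push_cast; rfl
  rw [h1, Real.rpow_add ht2, h2, meanCoeffSeries]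
  field_simp

theorem meanCoeffSeries_nonneg (m k : ℕ) : 0 ≤ meanCoeffSeries m k := by
  have h1 : 0 ≤ Real.Gamma ((m : ℝ) / 2) := Real.Gamma_nonneg_of_nonneg (by positivity)
  have h2 : 0 ≤ Real.Gamma ((k : ℝ) + (m : ℝ) / 2) := Real.Gamma_nonneg_of_nonneg (by positivity)
  unfold meanCoeffSeries
  positivity

theorem meanCoeffSeries_le {m : ℕ} (hm : 2 ≤ m) (k : ℕ) :
    meanCoeffSeries m k ≤ 1 / (k.factorial : ℝ) := by
  have hm1 : (1 : ℝ) ≤ (m : ℝ) / 2 := by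
    have : (2 : ℝ) ≤ m := by exact_mod_cast hm
    linarith
  have h1 : 0 < Real.Gamma ((m : ℝ) / 2) := Real.Gamma_pos_of_pos (by positivity)
  have h2 := Gamma_le_Gamma_natCast_add hm1 k
  have hf : (0 : ℝ) < k.factorial := by positivity
  rw [meanCoeffSeries, div_le_div_iff₀ (by nlinarith) hf]
  nlinarith

/-- With `s = (μ r / 2)²` the series begins `1 + (2 / m) s`, and `(2 / m) s = μ² r² / (2m)`. The
tail is `O(s²)` by comparison with the exponential series. -/
theorem tendsto_meanCoeff {m : ℕ} (hm : 2 ≤ m) {μ : ℝ} (hμ : 0 < μ) :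
    Tendsto (fun r => (meanCoeff m (μ * r) - 1) / r ^ 2) (𝓝[>] 0)
      (𝓝 (μ ^ 2 / (2 * m))) := by
  have hm0 : (0 : ℝ) < m := by positivity
  have hG : 0 < Real.Gamma ((m : ℝ) / 2) := Real.Gamma_pos_of_pos (by positivity)
  have c0 : meanCoeffSeries m 0 = 1 := by
    simp [meanCoeffSeries, hG.ne']
  have c1 : meanCoeffSeries m 1 = 2 / m := by
    have h : (1 : ℝ) + (m : ℝ) / 2 = (m : ℝ) / 2 + 1 := by ring
    simp only [meanCoeffSeries, Nat.factorial_one, Nat.cast_one, one_mul, h]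
    rw [Real.Gamma_add_one (by positivity)]
    field_simp
  have hexp : ∀ s : ℝ, Summable fun k : ℕ => s ^ k / (k.factorial : ℝ) :=
    Real.summable_pow_div_factorial
  have hsum : ∀ s : ℝ, 0 ≤ s → Summable fun k => meanCoeffSeries m k * s ^ k := fun s hs =>
    Summable.of_nonneg_of_le (fun k => mul_nonneg (meanCoeffSeries_nonneg m k) (by positivity))
      (fun k => by
        have := mul_le_mul_of_nonneg_right (meanCoeffSeries_le hm k) (pow_nonneg hs k)
        calc _ ≤ _ := this
          _ = s ^ k / (k.factorial : ℝ) := by ring) (hexp s)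
  have hkey : ∀ s : ℝ, 0 ≤ s → s ≤ 1 →
      |∑' k, meanCoeffSeries m k * s ^ k - 1 - 2 / m * s| ≤
        s ^ 2 * ∑' k : ℕ, 1 ^ k / (k.factorial : ℝ) := by
    intro s hs hs1
    have h := (hsum s hs).sum_add_tsum_nat_add 2
    simp only [Finset.sum_range_succ, Finset.sum_range_zero, c0, c1, pow_zero, pow_one] at h
    have hle : ∀ k : ℕ, meanCoeffSeries m (k + 2) * s ^ (k + 2) ≤
        s ^ 2 * (1 ^ k / (k.factorial : ℝ)) := by
      intro k
      have h1 : meanCoeffSeries m (k + 2) ≤ 1 / (k.factorial : ℝ) :=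
        (meanCoeffSeries_le hm _).trans (by
          gcongr
          omega)
      calc meanCoeffSeries m (k + 2) * s ^ (k + 2) ≤ 1 / (k.factorial : ℝ) * s ^ 2 := by
            refine mul_le_mul h1 (pow_le_pow_of_le_one hs hs1 (by omega)) (by positivity)
              (by positivity)
        _ = _ := by rw [one_pow]; ring
    have hnn : ∀ k, 0 ≤ meanCoeffSeries m (k + 2) * s ^ (k + 2) := fun k =>
      mul_nonneg (meanCoeffSeries_nonneg m _) (by positivity)
    have hT : ∑' k, meanCoeffSeries m (k + 2) * s ^ (k + 2) ≤
        s ^ 2 * ∑' k : ℕ, 1 ^ k / (k.factorial : ℝ) := by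
      rw [← tsum_mul_left]
      exact ((summable_nat_add_iff 2).2 (hsum s hs)).tsum_le_tsum hle ((hexp 1).mul_left _)
    rw [show ∑' k, meanCoeffSeries m k * s ^ k - 1 - 2 / m * s =
      ∑' k, meanCoeffSeries m (k + 2) * s ^ (k + 2) by linarith,
      abs_of_nonneg (tsum_nonneg hnn)]
    exact hT
  set C := ∑' k : ℕ, 1 ^ k / (k.factorial : ℝ)
  have hlim : Tendsto (fun r : ℝ => (μ / 2) ^ 4 * C * r ^ 2) (𝓝[>] 0) (𝓝 0) := by
    have : Continuous fun r : ℝ => (μ / 2) ^ 4 * C * r ^ 2 := by fun_prop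
    simpa using (this.tendsto 0).mono_left nhdsWithin_le_nhds
  refine tendsto_iff_norm_sub_tendsto_zero.2 (squeeze_zero' (Eventually.of_forall fun _ =>
    norm_nonneg _) ?_ hlim)
  have hsmall : ∀ᶠ r : ℝ in 𝓝[>] 0, r < 1 / μ :=
    nhdsWithin_le_nhds (eventually_lt_nhds (by positivity))
  filter_upwards [hsmall, self_mem_nhdsWithin] with r hr hr0
  replace hr0 : 0 < r := hr0
  have hr1 : μ * r < 1 := by rwa [lt_div_iff₀ hμ, mul_comm] at hr
  have h := hkey ((μ * r / 2) ^ 2) (by positivity) (pow_le_one₀ (by positivity) (by linarith))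
  rw [← meanCoeff_eq_tsum m (by positivity)] at h
  have heq : (meanCoeff m (μ * r) - 1) / r ^ 2 - μ ^ 2 / (2 * m) =
      (meanCoeff m (μ * r) - 1 - 2 / m * (μ * r / 2) ^ 2) / r ^ 2 := by
    field_simp
  rw [heq, norm_div, Real.norm_eq_abs, Real.norm_of_nonneg (by positivity : 0 ≤ r ^ 2),
    div_le_iff₀ (by positivity)]
  calc _ ≤ _ := h
    _ = _ := by ring

/-! ### Density of exponentials in the continuous functions on the sphere -/

/-- The `i`-th coordinate on the unit sphere. -/
def sphereCoord {m : ℕ} (i : Fin m) : C(sphere (0 : EuclideanSpace ℝ (Fin m)) 1, ℝ) :=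
  ⟨fun θ => θ.1 i, by fun_prop⟩

/-- A product of coordinates on the unit sphere. -/
def sphereMonomial {m n : ℕ} (p : Fin n → Fin m) : C(sphere (0 : EuclideanSpace ℝ (Fin m)) 1, ℝ) :=
  ∏ j, sphereCoord (p j)

/-- The function `θ ↦ exp (c ⟪ξ, θ⟫)` on the unit sphere. -/
def sphereExp {m : ℕ} (c : ℝ) (ξ : EuclideanSpace ℝ (Fin m)) :
    C(sphere (0 : EuclideanSpace ℝ (Fin m)) 1, ℝ) :=
  ⟨fun θ => Real.exp (c * inner ℝ ξ θ.1), by fun_prop⟩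

theorem norm_sphereMonomial_le {m n : ℕ} (p : Fin n → Fin m) : ‖sphereMonomial p‖ ≤ 1 := by
  refine (ContinuousMap.norm_le _ zero_le_one).2 fun θ => ?_
  simp only [sphereMonomial, ContinuousMap.prod_apply, norm_prod]
  refine Finset.prod_le_one (fun _ _ => norm_nonneg _) fun j _ => ?_
  calc ‖θ.1 (p j)‖ ≤ ‖θ.1‖ := PiLp.norm_apply_le _ _
    _ = 1 := norm_eq_of_mem_sphere θ

/-- Expanding `⟪ξ, θ⟫ ^ n` over words `p : Fin n → Fin m` instead of multi-indices avoids
multinomial coefficients and leaves an expression symmetric in `ξ` and `θ`. -/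
theorem hasSum_sphereExp {m : ℕ} (c : ℝ) (ξ : sphere (0 : EuclideanSpace ℝ (Fin m)) 1) :
    HasSum (fun n : ℕ => (c ^ n / n.factorial) •
      ∑ p : Fin n → Fin m, sphereMonomial p ξ • sphereMonomial p) (sphereExp c ξ.1) := by
  have h := NormedSpace.exp_series_hasSum_exp' (𝕂 := ℝ) (c • ∑ i, ξ.1 i • sphereCoord i)
  have he : NormedSpace.exp (c • ∑ i, ξ.1 i • sphereCoord i) = sphereExp c ξ.1 := by
    ext θ
    have := NormedSpace.map_exp
      (Pi.evalRingHom (fun _ => ℝ) θ |>.comp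
        (ContinuousMap.coeFnRingHom : C(sphere (0 : EuclideanSpace ℝ (Fin m)) 1, ℝ) →+* _))
      (continuous_eval_const θ) (c • ∑ i, ξ.1 i • sphereCoord i)
    refine this.trans ?_
    rw [← Real.exp_eq_exp_ℝ]
    simp [sphereExp, sphereCoord, PiLp.inner_apply, mul_comm]
  rw [he] at h
  convert! h using 2 with n
  rw [smul_pow, smul_smul, Finset.sum_pow', Fintype.piFinset_univ]
  congr 1
  · ring
  · refine Finset.sum_congr rfl fun p _ => ?_
    ext θ
    simp [sphereMonomial, sphereCoord, Finset.prod_mul_distrib]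

/-- Applying `Λ` to the expansion in `θ` gives a function of `ξ` that vanishes identically; applying
`Λ` again, now in `ξ`, gives a vanishing sum of squares with positive weights. -/
theorem dual_sphereMonomial_eq_zero {m : ℕ} {c : ℝ} (hc : 0 < c)
    (Λ : StrongDual ℝ C(sphere (0 : EuclideanSpace ℝ (Fin m)) 1, ℝ))
    (hΛ : ∀ ξ : sphere (0 : EuclideanSpace ℝ (Fin m)) 1, Λ (sphereExp c ξ.1) = 0)
    {n : ℕ} (p : Fin n → Fin m) : Λ (sphereMonomial p) = 0 := by
  let G : ℕ → C(sphere (0 : EuclideanSpace ℝ (Fin m)) 1, ℝ) := fun n =>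
    (c ^ n / n.factorial) • ∑ p : Fin n → Fin m, Λ (sphereMonomial p) • sphereMonomial p
  have hGs : Summable G := by
    -- There are `m ^ n` words of length `n`, each contributing at most `‖Λ‖`.
    refine Summable.of_norm_bounded (g := fun n => ‖Λ‖ * ((c * m) ^ n / n.factorial))
      ((Real.summable_pow_div_factorial _).mul_left _) fun n => ?_
    have h1 : ‖∑ p : Fin n → Fin m, Λ (sphereMonomial p) • sphereMonomial p‖ ≤
        m ^ n * ‖Λ‖ := by
      refine (norm_sum_le_of_le (f := fun p : Fin n → Fin m =>
        Λ (sphereMonomial p) • sphereMonomial p) Finset.univ (n := fun _ => ‖Λ‖)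
        fun p _ => ?_).trans (by simp)
      rw [norm_smul]
      have h2 := norm_sphereMonomial_le p
      have h3 : ‖Λ (sphereMonomial p)‖ ≤ ‖Λ‖ := Λ.le_of_opNorm_le_of_le le_rfl h2 |>.trans
        (by simp)
      calc _ ≤ ‖Λ‖ * 1 := by gcongr
        _ = _ := mul_one _
    simp only [G]
    rw [norm_smul, Real.norm_of_nonneg (by positivity), mul_pow]
    calc _ ≤ c ^ n / n.factorial * (m ^ n * ‖Λ‖) := by gcongr
      _ = _ := by ring
  have hG0 : HasSum G 0 := by
    convert! hGs.hasSum
    ext ξ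
    have h1 := (hasSum_sphereExp c ξ).mapL Λ
    rw [hΛ] at h1
    have h2 := hGs.hasSum.mapL (ContinuousMap.evalCLM ℝ ξ)
    refine h1.unique ?_
    convert! h2 using 2 with n
    simp [G, ContinuousMap.evalCLM, mul_comm]
  have hsq := hG0.mapL Λ
  rw [map_zero] at hsq
  have hval : ∀ n, Λ (G n) = c ^ n / n.factorial * ∑ p : Fin n → Fin m, Λ (sphereMonomial p) ^ 2 :=
    fun n => by simp [G, pow_two]
  have h0 := (hasSum_zero_iff_of_nonneg (fun n => by rw [hval]; positivity)).1 hsq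
  have hn := congrFun h0 n
  simp only [hval, Pi.zero_apply] at hn
  have hpos : c ^ n / n.factorial ≠ 0 := by positivity
  have := (mul_eq_zero.1 hn).resolve_left hpos
  rw [Finset.sum_eq_zero_iff_of_nonneg (fun _ _ => sq_nonneg _)] at this
  exact pow_eq_zero_iff two_ne_zero |>.1 (this p (Finset.mem_univ _))

/-- `Λ` kills all monomials, and these span a dense subalgebra by Stone–Weierstrass. -/
theorem dual_eq_zero_of_sphereExp {m : ℕ} {c : ℝ} (hc : 0 < c)
    (Λ : StrongDual ℝ C(sphere (0 : EuclideanSpace ℝ (Fin m)) 1, ℝ))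
    (hΛ : ∀ ξ : sphere (0 : EuclideanSpace ℝ (Fin m)) 1, Λ (sphereExp c ξ.1) = 0) : Λ = 0 := by
  let A : Subalgebra ℝ C(sphere (0 : EuclideanSpace ℝ (Fin m)) 1, ℝ) :=
    Algebra.adjoin ℝ (Set.range sphereCoord)
  have hsep : A.SeparatesPoints := by
    intro x y hxy
    have : ∃ i, x.1 i ≠ y.1 i := by
      by_contra! h
      exact hxy (Subtype.ext (PiLp.ext h))
    obtain ⟨i, hi⟩ := this
    exact ⟨_, ⟨sphereCoord i, Algebra.subset_adjoin ⟨i, rfl⟩, rfl⟩, hi⟩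
  have htop := ContinuousMap.subalgebra_topologicalClosure_eq_top_of_separatesPoints A hsep
  have hA : ∀ f ∈ A, Λ f = 0 := by
    intro f hf
    have hf' : f ∈ Submodule.span ℝ (SetLike.coe (Submonoid.closure (Set.range (sphereCoord (m := m))))) := by
      rw [← Algebra.adjoin_eq_span]; exact hf
    have hle : Submodule.span ℝ (SetLike.coe (Submonoid.closure (Set.range (sphereCoord (m := m))))) ≤ LinearMap.ker Λ.toLinearMap := by
      refine Submodule.span_le.2 fun g hg => ?_
      obtain ⟨l, hl, rfl⟩ := Submonoid.exists_list_of_mem_closure hg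
      have : ∀ j : Fin l.length, ∃ i, sphereCoord i = l.get j := fun j => hl _ (l.get_mem j)
      choose p hp using this
      have h1 : sphereMonomial p = l.prod := by
        rw [sphereMonomial, ← List.prod_ofFn]
        congr 1
        simp only [hp]
        exact List.ofFn_get l
      rw [← h1]
      exact dual_sphereMonomial_eq_zero hc Λ hΛ p
    exact hle hf'
  ext f
  have hf : f ∈ closure (A : Set C(sphere (0 : EuclideanSpace ℝ (Fin m)) 1, ℝ)) := by
    rw [← Subalgebra.topologicalClosure_coe, htop]; trivial
  exact closure_minimal hA (isClosed_eq Λ.continuous continuous_const) hf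

theorem dense_span_sphereExp {m : ℕ} {c : ℝ} (hc : 0 < c) :
    Dense (Submodule.span ℝ (Set.range
      fun ξ : sphere (0 : EuclideanSpace ℝ (Fin m)) 1 => sphereExp c ξ.1) :
      Set C(sphere (0 : EuclideanSpace ℝ (Fin m)) 1, ℝ)) := by
  set S := Submodule.span ℝ (Set.range
      fun ξ : sphere (0 : EuclideanSpace ℝ (Fin m)) 1 => sphereExp c ξ.1)
  intro f
  by_contra hf
  obtain ⟨Λ, u, hu, huf⟩ := geometric_hahn_banach_closed_point
    (S.topologicalClosure.convex) S.isClosed_topologicalClosure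
    (x := f) (by rwa [Submodule.topologicalClosure_coe])
  have hS : ∀ g ∈ S, Λ g = 0 := by
    intro g hg
    by_contra hne
    -- A functional bounded above by `u` on a subspace vanishes there: this multiple of `g` would
    -- take the value `u + 1`.
    have := hu (((u + 1) / Λ g) • g) (S.le_topologicalClosure (S.smul_mem _ hg))
    rw [map_smul, smul_eq_mul, div_mul_cancel₀ _ hne] at this
    linarith
  have h0 := dual_eq_zero_of_sphereExp hc Λ fun ξ => hS _ (Submodule.subset_span ⟨ξ, rfl⟩)
  have := hu 0 (zero_mem _)
  simp [h0] at this huf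
  linarith

/-! ### Exponential solutions and approximation on a sphere -/

/-- The exponential solution `x ↦ exp (μ ⟪ξ, x - x₀⟫)` of the modified Helmholtz equation. -/
def expSolution {m : ℕ} (μ : ℝ) (x₀ ξ : EuclideanSpace ℝ (Fin m)) :
    EuclideanSpace ℝ (Fin m) → ℝ :=
  fun x => Real.exp (μ * inner ℝ ξ (x - x₀))

/-- The linear span of the exponential solutions with unit direction. -/
def expSpan {m : ℕ} (μ : ℝ) (x₀ : EuclideanSpace ℝ (Fin m)) :
    Submodule ℝ (EuclideanSpace ℝ (Fin m) → ℝ) :=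
  Submodule.span ℝ (Set.range
    fun ξ : sphere (0 : EuclideanSpace ℝ (Fin m)) 1 => expSolution μ x₀ ξ.1)

theorem contDiff_expSolution {m : ℕ} (μ : ℝ) (x₀ ξ : EuclideanSpace ℝ (Fin m)) :
    ContDiff ℝ 2 (expSolution μ x₀ ξ) := by
  exact (contDiff_const.mul (contDiff_const.inner ℝ (contDiff_id.sub contDiff_const))).exp

theorem laplacian_expSolution {m : ℕ} (μ : ℝ) (x₀ ξ : EuclideanSpace ℝ (Fin m)) (hξ : ‖ξ‖ = 1)
    (x : EuclideanSpace ℝ (Fin m)) :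
    Laplacian.laplacian (expSolution μ x₀ ξ) x = μ ^ 2 * expSolution μ x₀ ξ x := by
  have h1 (y : EuclideanSpace ℝ (Fin m)) : HasFDerivAt (expSolution μ x₀ ξ)
      (expSolution μ x₀ ξ y • (μ • innerSL ℝ ξ)) y := by
    have h : HasFDerivAt (fun y => μ * inner ℝ ξ (y - x₀)) (μ • innerSL ℝ ξ) y := by
      have := ((innerSL ℝ ξ).hasFDerivAt.comp y ((hasFDerivAt_id y).sub_const x₀)).const_mul μ
      simpa [Function.comp_def] using this
    exact h.exp
  have h2 : fderiv ℝ (expSolution μ x₀ ξ) =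
      fun y => expSolution μ x₀ ξ y • (μ • innerSL ℝ ξ) := funext fun y => (h1 y).fderiv
  have h3 := ((h1 x).smul_const (μ • innerSL ℝ ξ)).fderiv
  rw [InnerProductSpace.laplacian_eq_iteratedFDeriv_orthonormalBasis _
    (EuclideanSpace.basisFun (Fin m) ℝ)]
  simp only [iteratedFDeriv_two_apply, h2, h3]
  have hn := EuclideanSpace.real_norm_sq_eq ξ
  rw [hξ] at hn
  calc _ = ∑ i, μ ^ 2 * expSolution μ x₀ ξ x * ξ i ^ 2 := by
        refine Finset.sum_congr rfl fun i _ => ?_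
        simp [EuclideanSpace.inner_single_right]
        ring
    _ = _ := by rw [← Finset.mul_sum, ← hn]; ring

theorem expSpan_solution {m : ℕ} {μ : ℝ} {x₀ : EuclideanSpace ℝ (Fin m)}
    {w : EuclideanSpace ℝ (Fin m) → ℝ} (hw : w ∈ expSpan μ x₀) :
    ContDiff ℝ 2 w ∧ ∀ x, Laplacian.laplacian w x = μ ^ 2 * w x := by
  induction hw using Submodule.span_induction with
  | mem w h =>
    obtain ⟨ξ, rfl⟩ := h
    exact ⟨contDiff_expSolution _ _ _, laplacian_expSolution _ _ _ (norm_eq_of_mem_sphere ξ)⟩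
  | zero =>
    refine ⟨contDiff_const, fun x => ?_⟩
    have := InnerProductSpace.laplacian_const (E := EuclideanSpace ℝ (Fin m)) (c := (0 : ℝ))
    rw [Pi.zero_apply, mul_zero]
    exact congrFun this x
  | add f g _ _ hf hg =>
    refine ⟨hf.1.add hg.1, fun x => ?_⟩
    rw [hf.1.contDiffAt.laplacian_add hg.1.contDiffAt, hf.2, hg.2, Pi.add_apply, mul_add]
  | smul a f _ hf =>
    refine ⟨hf.1.const_smul a, fun x => ?_⟩
    rw [InnerProductSpace.laplacian_smul a hf.1.contDiffAt, hf.2]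
    simp only [smul_eq_mul, Pi.smul_apply]
    ring

theorem exists_expSpan_near_on_sphere {m : ℕ} {μ : ℝ} (hμ : 0 < μ) (x₀ : EuclideanSpace ℝ (Fin m))
    {R : ℝ} (hR : 0 < R) {v : EuclideanSpace ℝ (Fin m) → ℝ}
    (hv : ContinuousOn v (sphere x₀ R)) {ε : ℝ} (hε : 0 < ε) :
    ∃ w ∈ expSpan μ x₀, ∀ y ∈ sphere x₀ R, |v y - w y| ≤ ε := by
  have hmem (θ : sphere (0 : EuclideanSpace ℝ (Fin m)) 1) :
      x₀ + R • (θ : EuclideanSpace ℝ (Fin m)) ∈ sphere x₀ R := by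
    simp [norm_smul, abs_of_pos hR]
  let V : C(sphere (0 : EuclideanSpace ℝ (Fin m)) 1, ℝ) :=
    ⟨fun θ => v (x₀ + R • (θ : EuclideanSpace ℝ (Fin m))),
      hv.comp_continuous (by fun_prop) hmem⟩
  obtain ⟨g, hg, hgV⟩ := Metric.mem_closure_iff.1
    (dense_span_sphereExp (m := m) (c := μ * R) (by positivity) V) ε hε
  have hlift : ∃ w ∈ expSpan μ x₀, ∀ θ : sphere (0 : EuclideanSpace ℝ (Fin m)) 1,
      w (x₀ + R • (θ : EuclideanSpace ℝ (Fin m))) = g θ := by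
    clear hgV
    induction hg using Submodule.span_induction with
    | mem g h =>
      obtain ⟨ξ, rfl⟩ := h
      refine ⟨_, Submodule.subset_span ⟨ξ, rfl⟩, fun θ => ?_⟩
      simp [expSolution, sphereExp, inner_smul_right, mul_assoc]
    | zero => exact ⟨0, zero_mem _, fun _ => rfl⟩
    | add f g _ _ hf hg =>
      obtain ⟨w, hw, hwf⟩ := hf
      obtain ⟨w', hw', hwg⟩ := hg
      exact ⟨w + w', add_mem hw hw', fun θ => by simp [hwf, hwg]⟩
    | smul a f _ hf =>
      obtain ⟨w, hw, hwf⟩ := hf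
      exact ⟨a • w, Submodule.smul_mem _ a hw, fun θ => by simp [hwf]⟩
  obtain ⟨w, hw, hwg⟩ := hlift
  refine ⟨w, hw, fun y hy => ?_⟩
  have hy' : ‖y - x₀‖ = R := by rwa [← dist_eq_norm]
  let θ : sphere (0 : EuclideanSpace ℝ (Fin m)) 1 :=
    ⟨R⁻¹ • (y - x₀), by simp [norm_smul, hy', abs_of_pos hR, hR.ne']⟩
  have hθ : x₀ + R • (θ : EuclideanSpace ℝ (Fin m)) = y := by
    simp [θ, smul_smul, hR.ne']
  have h1 := (ContinuousMap.dist_apply_le_dist (f := V) (g := g) θ).trans hgV.le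
  rw [Real.dist_eq, ← hwg θ] at h1
  simp only [V, ContinuousMap.coe_mk, hθ] at h1
  exact h1

/-! ### Comparison principle -/

theorem sphereMean_neg {m : ℕ} (v : EuclideanSpace ℝ (Fin m) → ℝ) (x : EuclideanSpace ℝ (Fin m))
    (r : ℝ) : sphereMean (-v) x r = -sphereMean v x r := by
  simp [sphereMean, sphereIntegral, integral_neg]

theorem sphereMean_sub_le {m : ℕ} (hm : 2 ≤ m) {v w : EuclideanSpace ℝ (Fin m) → ℝ}
    {x : EuclideanSpace ℝ (Fin m)} {r M : ℝ} (hr : 0 < r) (hv : ContinuousOn v (sphere x r))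
    (hw : ContinuousOn w (sphere x r)) (h : ∀ y ∈ sphere x r, v y - w y ≤ M) :
    sphereMean v x r - sphereMean w x r ≤ M := by
  have hS := toSphere_real_univ_pos hm
  have hmem (θ : sphere (0 : EuclideanSpace ℝ (Fin m)) 1) :
      x + r • (θ : EuclideanSpace ℝ (Fin m)) ∈ sphere x r := by
    simp [norm_smul, abs_of_pos hr]
  have iv := integrable_sphere (hv.comp_continuous (by fun_prop) hmem)
  have iw := integrable_sphere (hw.comp_continuous (by fun_prop) hmem)
  simp only [Function.comp_def] at iv iw
  rw [sphereMean_eq hm v x hr, sphereMean_eq hm w x hr, ← mul_sub, ← integral_sub iv iw,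
    inv_mul_le_iff₀ hS]
  refine (integral_mono (iv.sub iw) (integrable_const M) fun θ => h _ (hmem θ)).trans ?_
  rw [integral_const, smul_eq_mul]

/-- The one-sided comparison principle on a ball. -/
theorem sub_le_of_sub_le_on_sphere {m : ℕ} (hm : 2 ≤ m) {μ : ℝ} (hμ : 0 < μ)
    {x₀ : EuclideanSpace ℝ (Fin m)} {R : ℝ} {v w : EuclideanSpace ℝ (Fin m) → ℝ}
    (hv : ContinuousOn v (closedBall x₀ R))
    (hmean : ∀ x ∈ ball x₀ R, ∀ᶠ r in 𝓝[>] 0, meanCoeff m (μ * r) * v x = sphereMean v x r)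
    (hw : ContDiff ℝ 2 w) (hΔ : ∀ x, Laplacian.laplacian w x = μ ^ 2 * w x)
    {ε : ℝ} (hε : 0 ≤ ε) (h : ∀ y ∈ sphere x₀ R, v y - w y ≤ ε) :
    ∀ y ∈ closedBall x₀ R, v y - w y ≤ ε := by
  intro y hy
  by_contra! hlt
  -- At an interior maximum `x` of `v - w`, the means of `v - w` over small spheres are at most its
  -- value at `x`. Dividing by `r²` and letting `r → 0` gives `μ² v x ≤ μ² w x`, against `v x - w x
  -- > ε ≥ 0`.
  obtain ⟨x, hx, hmax⟩ := (isCompact_closedBall x₀ R).exists_isMaxOn ⟨y, hy⟩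
    (hv.sub hw.continuous.continuousOn)
  have hux : ε < v x - w x := hlt.trans_le (hmax hy)
  have hxb : x ∈ ball x₀ R := by
    rcases (mem_closedBall.1 hx).lt_or_eq with h1 | h1
    · exact h1
    · exact absurd (h x h1) (not_le.2 hux)
  have hsmall : ∀ᶠ r : ℝ in 𝓝[>] 0, r < R - dist x x₀ :=
    nhdsWithin_le_nhds (eventually_lt_nhds (sub_pos.2 hxb))
  have hle : ∀ᶠ r : ℝ in 𝓝[>] 0, (meanCoeff m (μ * r) - 1) / r ^ 2 * v x ≤
      (sphereMean w x r - w x) / r ^ 2 := by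
    filter_upwards [hsmall, self_mem_nhdsWithin, hmean x hxb] with r hr hr0 hM
    have hsub : sphere x r ⊆ closedBall x₀ R := fun z hz => by
      rw [mem_closedBall]
      have h1 := dist_triangle z x x₀
      have h2 : dist z x = r := hz
      linarith
    have := sphereMean_sub_le hm hr0 (hv.mono hsub) hw.continuous.continuousOn
      fun z hz => hmax (hsub hz)
    rw [← hM, Pi.sub_apply] at this
    have hr2 : 0 < r ^ 2 := pow_pos hr0 2
    rw [div_mul_eq_mul_div]
    refine (div_le_div_iff_of_pos_right hr2).2 ?_
    linarith
  have hlim := le_of_tendsto_of_tendsto ((tendsto_meanCoeff hm hμ).mul_const (v x))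
    (tendsto_sphereMean hm hw.contDiffAt) hle
  rw [hΔ, mul_div_right_comm] at hlim
  have hm0 : (0 : ℝ) < m := by positivity
  have := le_of_mul_le_mul_left hlim (by positivity)
  linarith

theorem abs_sub_le_of_abs_sub_le_on_sphere {m : ℕ} (hm : 2 ≤ m) {μ : ℝ} (hμ : 0 < μ)
    {x₀ : EuclideanSpace ℝ (Fin m)} {R : ℝ} {v w : EuclideanSpace ℝ (Fin m) → ℝ}
    (hv : ContinuousOn v (closedBall x₀ R))
    (hmean : ∀ x ∈ ball x₀ R, ∀ᶠ r in 𝓝[>] 0, meanCoeff m (μ * r) * v x = sphereMean v x r)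
    (hw : ContDiff ℝ 2 w) (hΔ : ∀ x, Laplacian.laplacian w x = μ ^ 2 * w x)
    {ε : ℝ} (hε : 0 ≤ ε) (h : ∀ y ∈ sphere x₀ R, |v y - w y| ≤ ε) :
    ∀ y ∈ closedBall x₀ R, |v y - w y| ≤ ε := by
  intro y hy
  have h1 := sub_le_of_sub_le_on_sphere hm hμ hv hmean hw hΔ hε
    (fun y hy => (abs_le.1 (h y hy)).2) y hy
  -- The mean value property and the equation are linear, so the lower bound is the upper bound for
  -- `-v` and `-w`.
  have h2 := sub_le_of_sub_le_on_sphere hm hμ (v := -v) (w := -w) hv.neg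
    (fun x hx => (hmean x hx).mono fun r hr => by
      rw [sphereMean_neg, ← hr, Pi.neg_apply, mul_neg])
    hw.neg (fun x => by rw [InnerProductSpace.laplacian_neg, Pi.neg_apply, hΔ, Pi.neg_apply,
      mul_neg]) hε
    (fun y hy => by
      have := (abs_le.1 (h y hy)).1
      simp only [Pi.neg_apply]
      linarith) y hy
  simp only [Pi.neg_apply] at h2
  exact abs_le.2 ⟨by linarith, h1⟩

/-! ### Regularity by radial averaging -/

/-- A smooth radial bump function supported in the closed ball of radius `δ`. -/
def radialBump {m : ℕ} (δ : ℝ) (y : EuclideanSpace ℝ (Fin m)) : ℝ :=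
  expNegInvGlue (δ ^ 2 - ‖y‖ ^ 2)

theorem contDiff_radialBump {m : ℕ} (δ : ℝ) :
    ContDiff ℝ 2 (radialBump (m := m) δ) :=
  expNegInvGlue.contDiff.comp (contDiff_const.sub (contDiff_norm_sq ℝ))

theorem radialBump_eq_zero {m : ℕ} {δ : ℝ} (hδ : 0 < δ) {y : EuclideanSpace ℝ (Fin m)}
    (hy : δ ≤ ‖y‖) : radialBump δ y = 0 :=
  expNegInvGlue.zero_of_nonpos (by nlinarith)

theorem hasCompactSupport_radialBump {m : ℕ} {δ : ℝ} (hδ : 0 < δ) :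
    HasCompactSupport (radialBump (m := m) δ) :=
  HasCompactSupport.intro (isCompact_closedBall 0 δ) fun y hy => radialBump_eq_zero hδ (by
    simpa using (not_le.1 (fun h => hy (mem_closedBall_zero_iff.2 h))).le)

theorem radialBump_nonneg {m : ℕ} (δ : ℝ) (y : EuclideanSpace ℝ (Fin m)) :
    0 ≤ radialBump δ y :=
  expNegInvGlue.nonneg _

theorem integrable_radialBump_mul {m : ℕ} {δ : ℝ} (hδ : 0 < δ)
    {f : EuclideanSpace ℝ (Fin m) → ℝ} (hf : Continuous f) :
    Integrable fun y => radialBump δ y * f y :=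
  ((contDiff_radialBump δ).continuous.mul hf).integrable_of_hasCompactSupport
    (hasCompactSupport_radialBump hδ).mul_right

theorem integral_radialBump_exp_pos {m : ℕ} {δ : ℝ} (hδ : 0 < δ) (μ : ℝ)
    (ξ : EuclideanSpace ℝ (Fin m)) :
    0 < ∫ y, radialBump δ y * Real.exp (μ * inner ℝ ξ (-y)) := by
  have hc : Continuous fun y : EuclideanSpace ℝ (Fin m) =>
      Real.exp (μ * inner ℝ ξ (-y)) := by fun_prop
  refine Continuous.integral_pos_of_hasCompactSupport_nonneg_nonzero
    ((contDiff_radialBump δ).continuous.mul hc) (hasCompactSupport_radialBump hδ).mul_right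
    (fun y => mul_nonneg (radialBump_nonneg _ _) (Real.exp_pos _).le) (x := 0) ?_
  refine mul_ne_zero (expNegInvGlue.pos_of_pos ?_).ne' (Real.exp_pos _).ne'
  simpa using pow_pos hδ 2

/-- The reflection exchanging `ξ` and `η` preserves both the volume and the bump; this is why one
constant serves all directions. -/
theorem integral_radialBump_exp_eq {m : ℕ} (δ μ : ℝ) {ξ η : EuclideanSpace ℝ (Fin m)}
    (h : ‖ξ‖ = ‖η‖) :
    ∫ y, radialBump δ y * Real.exp (μ * inner ℝ ξ (-y)) =
      ∫ y, radialBump δ y * Real.exp (μ * inner ℝ η (-y)) := by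
  let L := (Submodule.span ℝ {ξ - η})ᗮ.reflection
  have hL : L ξ = η := Submodule.reflection_sub h
  rw [← L.measurePreserving.integral_comp L.toHomeomorph.measurableEmbedding
    (fun y => radialBump δ y * Real.exp (μ * inner ℝ η (-y)))]
  refine integral_congr_ae (Eventually.of_forall fun y => ?_)
  simp only [radialBump, LinearIsometryEquiv.norm_map, inner_neg_right]
  rw [← hL, L.inner_map_map]

/-- Averaging against a radial bump multiplies the span of the exponentials by a constant. -/
theorem exists_integral_radialBump_mul {m : ℕ} {δ : ℝ} (hδ : 0 < δ) (μ : ℝ)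
    (x₀ : EuclideanSpace ℝ (Fin m)) :
    ∃ C > 0, ∀ w ∈ expSpan μ x₀, ∀ x, ∫ y, radialBump δ y * w (x - y) = C * w x := by
  have key : ∃ C > 0, ∀ ξ : sphere (0 : EuclideanSpace ℝ (Fin m)) 1,
      ∫ y, radialBump δ y * Real.exp (μ * inner ℝ ξ.1 (-y)) = C := by
    -- The unit sphere is empty when `m = 0`; any positive constant then works.
    by_cases hne : Nonempty (sphere (0 : EuclideanSpace ℝ (Fin m)) 1)
    · obtain ⟨ξ₀⟩ := hne
      exact ⟨_, integral_radialBump_exp_pos hδ μ ξ₀.1, fun ξ => integral_radialBump_exp_eq δ μ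
        (by rw [norm_eq_of_mem_sphere, norm_eq_of_mem_sphere])⟩
    · exact ⟨1, one_pos, fun ξ => (hne ⟨ξ⟩).elim⟩
  obtain ⟨C, hC, hξ⟩ := key
  refine ⟨C, hC, fun w hw x => ?_⟩
  induction hw using Submodule.span_induction with
  | mem w h =>
    obtain ⟨ξ, rfl⟩ := h
    rw [← hξ ξ, ← integral_mul_const]
    refine integral_congr_ae (Eventually.of_forall fun y => ?_)
    have h1 : μ * inner ℝ ξ.1 (x - y - x₀) =
        μ * inner ℝ ξ.1 (-y) + μ * inner ℝ ξ.1 (x - x₀) := by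
      rw [← mul_add, ← inner_add_right]
      congr 2
      abel
    simp only [expSolution, h1, Real.exp_add]
    ring
  | zero => simp
  | add f g hf' hg' hf hg =>
    have cf := (expSpan_solution hf').1.continuous
    have cg := (expSpan_solution hg').1.continuous
    simp only [Pi.add_apply, mul_add]
    rw [integral_add (integrable_radialBump_mul hδ (by fun_prop))
      (integrable_radialBump_mul hδ (by fun_prop)), hf, hg]
  | smul a f _ hf =>
    simp only [Pi.smul_apply, smul_eq_mul]
    rw [mul_left_comm, ← hf, ← integral_const_mul]
    exact integral_congr_ae (Eventually.of_forall fun y => by ring)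

theorem contDiffAt_of_expSpan_approx {m : ℕ} {μ : ℝ} {x₀ : EuclideanSpace ℝ (Fin m)} {R : ℝ}
    (hR : 0 < R) {v : EuclideanSpace ℝ (Fin m) → ℝ} (hv : ContinuousOn v (closedBall x₀ R))
    (happrox : ∀ ε > 0, ∃ w ∈ expSpan μ x₀, ∀ y ∈ closedBall x₀ R, |v y - w y| ≤ ε) :
    ContDiffAt ℝ 2 v x₀ := by
  -- For `x` within `δ` of `x₀` and `‖y‖ < δ`, the point `x - y` stays in the ball of radius `R`, so
  -- the convolution sees only values of `v` there.
  set δ := R / 2 with hδ_def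
  have hδ : 0 < δ := half_pos hR
  obtain ⟨C, hC, hCw⟩ := exists_integral_radialBump_mul (m := m) hδ μ x₀
  set g : EuclideanSpace ℝ (Fin m) → ℝ := (closedBall x₀ R).indicator v
  have hg : LocallyIntegrable g := by
    refine Integrable.locallyIntegrable ?_
    exact (integrable_indicator_iff measurableSet_closedBall).2
      (hv.integrableOn_compact (isCompact_closedBall _ _))
  set F := radialBump (m := m) δ ⋆[ContinuousLinearMap.lsmul ℝ ℝ] g
  have hF : ContDiff ℝ 2 F :=
    (hasCompactSupport_radialBump hδ).contDiff_convolution_left _ (contDiff_radialBump δ) hg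
  have hFv : ∀ x ∈ ball x₀ δ, F x = C * v x := by
    intro x hx
    have hxR : x ∈ closedBall x₀ R := by
      rw [mem_ball] at hx
      rw [mem_closedBall]
      linarith
    have hi : Integrable fun y => radialBump δ y * g (x - y) :=
      (hasCompactSupport_radialBump hδ).convolutionExists_left
        (ContinuousLinearMap.lsmul ℝ ℝ) (contDiff_radialBump δ).continuous hg x
    have hb : Integrable (radialBump (m := m) δ) := by
      simpa using integrable_radialBump_mul (m := m) hδ (continuous_const (y := (1 : ℝ)))
    -- Both `F` and `C * v` are compared with `C * w`, for `w` in the span within `ε` of `v`.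
    have hbound : ∀ ε > 0, |F x - C * v x| ≤ ε * ((∫ y, radialBump (m := m) δ y) + C) := by
      intro ε hε
      obtain ⟨w, hw, hvw⟩ := happrox ε hε
      have cw := (expSpan_solution hw).1.continuous
      have hiw : Integrable fun y => radialBump δ y * w (x - y) :=
        integrable_radialBump_mul hδ (by fun_prop)
      have h1 : |F x - C * w x| ≤ ε * ∫ y, radialBump (m := m) δ y := by
        rw [← hCw w hw x, ← integral_const_mul]
        change |(∫ y, radialBump δ y * g (x - y)) - _| ≤ _
        rw [← integral_sub hi hiw, ← Real.norm_eq_abs]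
        refine norm_integral_le_of_norm_le (hb.const_mul ε) (Eventually.of_forall fun y => ?_)
        rcases le_or_gt δ ‖y‖ with hy | hy
        · simp [radialBump_eq_zero hδ hy]
        · have hmem : x - y ∈ closedBall x₀ R := by
            rw [mem_ball] at hx
            have h2 := dist_triangle (x - y) x x₀
            have h3 : dist (x - y) x = ‖y‖ := by simp
            rw [mem_closedBall]
            linarith
          have h2 := hvw _ hmem
          simp only [g, Set.indicator_of_mem hmem]
          rw [← mul_sub, norm_mul, Real.norm_of_nonneg (radialBump_nonneg _ _), Real.norm_eq_abs,
            mul_comm]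
          exact mul_le_mul_of_nonneg_right h2 (radialBump_nonneg _ _)
      have h2 : |C * w x - C * v x| ≤ ε * C := by
        rw [← mul_sub, abs_mul, abs_of_pos hC, abs_sub_comm, mul_comm]
        exact mul_le_mul_of_nonneg_right (hvw x hxR) hC.le
      calc _ ≤ |F x - C * w x| + |C * w x - C * v x| := abs_sub_le _ _ _
        _ ≤ _ := by rw [mul_add]; exact add_le_add h1 h2
    have hK : 0 < (∫ y, radialBump (m := m) δ y) + C :=
      add_pos_of_nonneg_of_pos (integral_nonneg (radialBump_nonneg δ)) hC
    have h0 : |F x - C * v x| ≤ 0 := by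
      refine le_of_forall_pos_le_add fun ε hε => ?_
      have := hbound (ε / ((∫ y, radialBump (m := m) δ y) + C)) (by positivity)
      rwa [div_mul_cancel₀ _ hK.ne', ← zero_add ε] at this
    exact sub_eq_zero.1 (abs_nonpos_iff.1 h0)
  have hev : v =ᶠ[𝓝 x₀] fun x => C⁻¹ * F x := by
    filter_upwards [ball_mem_nhds x₀ hδ] with x hx
    rw [hFv x hx, inv_mul_cancel_left₀ hC.ne']
  exact (contDiff_const.mul hF).contDiffAt.congr_of_eventuallyEq hev

end ModifiedHelmholtz

end

/-! ### The main theorem -/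

open Filter Topology ModifiedHelmholtz in
theorem theorem7 (m : ℕ) (hm : 2 ≤ m) (D : Set (EuclideanSpace ℝ (Fin m)))
    (hDopen : IsOpen D) (hDconn : IsConnected D) (hDbdd : Bornology.IsBounded D)
    (v : EuclideanSpace ℝ (Fin m) → ℝ) (hv : ContinuousOn v D)
    (μ : ℝ) (hμ : 0 < μ)
    (ρ : EuclideanSpace ℝ (Fin m) → ℝ)
    (hρ : ∀ x ∈ D, 0 < ρ x ∧ Metric.closedBall x (ρ x) ⊆ D)
    (hmean : ∀ x ∈ D, ∀ r ∈ Set.Ioo 0 (ρ x),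
      ModifiedHelmholtz.meanCoeff m (μ * r) * v x = ModifiedHelmholtz.sphereMean v x r) :
    ContDiffOn ℝ 2 v D ∧ ∀ x ∈ D, Laplacian.laplacian v x - μ ^ 2 * v x = 0 := by
  have hmean' : ∀ x ∈ D, ∀ᶠ r in 𝓝[>] 0, meanCoeff m (μ * r) * v x = sphereMean v x r :=
    fun x hx => (Ioo_mem_nhdsGT (hρ x hx).1 : _ ∈ 𝓝[>] (0 : ℝ)) |> fun h =>
      Filter.mem_of_superset h (hmean x hx)
  have hC : ∀ x ∈ D, ContDiffAt ℝ 2 v x := by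
    intro x hx
    obtain ⟨hR, hsub⟩ := hρ x hx
    have hvR := hv.mono hsub
    refine contDiffAt_of_expSpan_approx (μ := μ) hR hvR fun ε hε => ?_
    obtain ⟨w, hw, hvw⟩ := exists_expSpan_near_on_sphere hμ x hR
      (hvR.mono Metric.sphere_subset_closedBall) hε
    obtain ⟨hw2, hΔ⟩ := expSpan_solution hw
    exact ⟨w, hw, abs_sub_le_of_abs_sub_le_on_sphere hm hμ hvR
      (fun y hy => hmean' y (hsub (Metric.ball_subset_closedBall hy))) hw2 hΔ hε.le hvw⟩
  refine ⟨fun x hx => (hC x hx).contDiffWithinAt, fun x hx => ?_⟩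
  have h1 := (tendsto_meanCoeff hm hμ).mul_const (v x)
  -- By the mean value property this is the difference quotient of the spherical means, so it has a
  -- second limit, now that `v` is known to be `C^2` at `x`.
  have h2 : Tendsto (fun r => (meanCoeff m (μ * r) - 1) / r ^ 2 * v x) (𝓝[>] 0)
      (𝓝 (Laplacian.laplacian v x / (2 * m))) := by
    refine (tendsto_sphereMean hm (hC x hx)).congr' ?_
    filter_upwards [hmean' x hx] with r hr
    rw [← hr]
    ring
  have h3 := tendsto_nhds_unique h1 h2
  have hm0 : (0 : ℝ) < m := by positivity
  field_simp at h3
  linarith
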